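/- Write $[x,y]=x^{-1}y^{-1}xy$. A string C-group of rank $d$ is a pair $(G,\{\rho_0,\dots,\rho_{d-1}\})$ where $G$ is a group generated by the involutions $\rho_0,\dots,\rho_{d-1}$ such that $\rho_i$ and $\rho_j$ commute whenever $|i-j|>1$, and $G_I\cap G_J=G_{I\cap J}$ for all $I,J\subseteq\{0,\dots,d-1\}$, where $G_I=\langle\rho_i : i\in I\rangle$. Its order is $|G|$, and its Schläfli type is $\{p_1,\dots,p_{d-1}\}$, where $p_i$ is the order of $\rho_{i-1}\rho_i$. Let $n\ge 10$ be an integer and let $$G_1=\langle \rho_0,\rho_1,\rho_2 \mid \rho_0^2,\ \rho_1^2,\ \rho_2^2,\ (\rho_0\rho_1)^{2^2},\ (\rho_1\rho_2)^{2^{n-3}},\ (\rho_0\rho_2)^2,\ [(\rho_0\rho_1)^2,\rho_2]\rangle,$$ $$G_3=\langle \rho_0,\rho_1,\rho_2 \mid \rho_0^2,\ \rho_1^2,\ \rho_2^2,\ (\rho_0\rho_1)^{2^2},\ (\rho_1\rho_2)^{2^{n-4}},\ (\rho_0\rho_2)^2,\ [(\rho_0\rho_1)^2,(\rho_1\rho_2)^2]\rangle,$$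 $$G_5=\langle \rho_0,\rho_1,\rho_2 \mid \rho_0^2,\ \rho_1^2,\ \rho_2^2,\ (\rho_0\rho_1)^{2^2},\ (\rho_1\rho_2)^{2^{n-5}},\ (\rho_0\rho_2)^2,\ [\rho_0,(\rho_1\rho_2)^2]^2,\ [\rho_0,(\rho_1\rho_2)^4]\rangle.$$ Then the pairs $(G_1,\{\rho_0,\rho_1,\rho_2\})$, $(G_3,\{\rho_0,\rho_1,\rho_2\})$ and $(G_5,\{\rho_0,\rho_1,\rho_2\})$ are string C-groups of order $2^n$ with Schläfli types $\{4,2^{n-3}\}$, $\{4,2^{n-4}\}$ and $\{4,2^{n-5}\}$, respectively. -/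

import Mathlib

namespace StringCGroup

/-- The commutator in the convention `[x, y] = x⁻¹ y⁻¹ x y`
(Mathlib's `⁅x, y⁆` is `x y x⁻¹ y⁻¹`). -/
def comm {G : Type*} [Group G] (x y : G) : G := x⁻¹ * y⁻¹ * x * y

/-- For `I ⊆ {0, …, d-1}`, the subgroup `G_I` generated by the `ρ i` with `i ∈ I`. -/
def parabolic {G : Type*} [Group G] {d : ℕ} (ρ : Fin d → G) (I : Set (Fin d)) : Subgroup G :=
  Subgroup.closure (ρ '' I)

/-- `(G, {ρ 0, …, ρ (d-1)})` is a string C-group of rank `d`. -/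
structure IsStringCGroup {G : Type*} [Group G] {d : ℕ} (ρ : Fin d → G) : Prop where
  /-- The `ρ i` are involutions. -/
  involution : ∀ i, orderOf (ρ i) = 2
  /-- The `ρ i` generate `G`. -/
  generate : Subgroup.closure (Set.range ρ) = ⊤
  /-- The string property: `ρ i` and `ρ j` commute whenever `|i - j| > 1`. -/
  string : ∀ i j : Fin d, 1 < |(i : ℤ) - (j : ℤ)| → Commute (ρ i) (ρ j)
  /-- The intersection property: `G_I ∩ G_J = G_{I ∩ J}` for all `I, J`. -/
  intersection : ∀ I J : Set (Fin d), parabolic ρ I ⊓ parabolic ρ J = parabolic ρ (I ∩ J)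

/-- The pair has Schläfli type `{p 0, …, p (d-1)}` (rank `d + 1`): the order of
`ρ i * ρ (i+1)` is `p i`. -/
def HasSchlafliType {G : Type*} [Group G] {d : ℕ} (ρ : Fin (d + 1) → G) (p : Fin d → ℕ) : Prop :=
  ∀ i : Fin d, orderOf (ρ i.castSucc * ρ i.succ) = p i

/-- The free generators `ρ₀, ρ₁, ρ₂`. -/
abbrev x (i : Fin 3) : FreeGroup (Fin 3) := FreeGroup.of i

/-- The relators `ρ₀², ρ₁², ρ₂², (ρ₀ρ₁)^(2²), (ρ₁ρ₂)^(2^t), (ρ₀ρ₂)²`. -/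
def baseRels (t : ℕ) : Set (FreeGroup (Fin 3)) :=
  {x 0 ^ 2, x 1 ^ 2, x 2 ^ 2, (x 0 * x 1) ^ 2 ^ 2, (x 1 * x 2) ^ 2 ^ t, (x 0 * x 2) ^ 2}

/-- Relators of `G₁`. -/
def rels₁ (n : ℕ) : Set (FreeGroup (Fin 3)) :=
  baseRels (n - 3) ∪ {comm ((x 0 * x 1) ^ 2) (x 2)}

/-- Relators of `G₃`. -/
def rels₃ (n : ℕ) : Set (FreeGroup (Fin 3)) :=
  baseRels (n - 4) ∪ {comm ((x 0 * x 1) ^ 2) ((x 1 * x 2) ^ 2)}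

/-- Relators of `G₅`. -/
def rels₅ (n : ℕ) : Set (FreeGroup (Fin 3)) :=
  baseRels (n - 5) ∪ {comm (x 0) ((x 1 * x 2) ^ 2) ^ 2, comm (x 0) ((x 1 * x 2) ^ 4)}

/-- The group `G₁` of parameter `n`. -/
abbrev G₁ (n : ℕ) : Type := PresentedGroup (rels₁ n)

/-- The group `G₃` of parameter `n`. -/
abbrev G₃ (n : ℕ) : Type := PresentedGroup (rels₃ n)

/-- The group `G₅` of parameter `n`. -/
abbrev G₅ (n : ℕ) : Type := PresentedGroup (rels₅ n)

/-- The images `ρ₀, ρ₁, ρ₂` of the free generators in a presented group. -/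
def gen (R : Set (FreeGroup (Fin 3))) : Fin 3 → PresentedGroup R := PresentedGroup.of

end StringCGroup

/-!
Put `a₀ = ρ₀`, `a₁ = ρ₁a₀ρ₁`, `a₂ = ρ₂a₁ρ₂`, `a₃ = ρ₁a₂ρ₁`, …. The relations of `G₁`, `G₃` and
`G₅` force the first `r = 2, 3, 4` of these involutions, respectively, to commute and to generate
the next one, so they generate an elementary abelian normal subgroup `N`. Killing `ρ₀` retracts
the group onto `⟨ρ₁, ρ₂⟩`, which is dihedral of order `2 ^ (t + 1)`, where `2 ^ t` is the
prescribed order of `ρ₁ρ₂`, because the relations beyond the base ones become trivial; hence the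
group is `N ⋊ ⟨ρ₁, ρ₂⟩`. A representation by signed permutations shows that `a₀, …, a_{r-1}` are
independent, so the order is `2 ^ (r + t + 1)`. The intersection property only has to be checked
for the maximal parabolic subgroups, where it follows from the retraction.
-/

namespace StringCGroup

variable {G : Type*} [Group G]

section Involutions

theorem eq_one_or_eq_of_mem_zpowers {t y : G} (ht : t ^ 2 = 1) (hy : y ∈ Subgroup.zpowers t) :
    y = 1 ∨ y = t := by
  have ht' : t ^ (2 : ℤ) = 1 := mod_cast ht
  obtain ⟨k, rfl⟩ := hy
  obtain ⟨l, rfl | rfl⟩ := k.even_or_odd'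
  · left; simp only [zpow_mul, ht', one_zpow]
  · right; simp only [zpow_add_one, zpow_mul, ht', one_zpow, one_mul]

theorem inv_eq_self_of_sq_eq_one {t : G} (ht : t ^ 2 = 1) : t⁻¹ = t :=
  inv_eq_of_mul_eq_one_left (by rw [← pow_two, ht])

theorem commute_of_sq_mul_eq_one {x y : G} (hx : x ^ 2 = 1) (hy : y ^ 2 = 1)
    (hxy : (x * y) ^ 2 = 1) : Commute x y := by
  have := inv_eq_self_of_sq_eq_one hxy
  rwa [mul_inv_rev, inv_eq_self_of_sq_eq_one hx, inv_eq_self_of_sq_eq_one hy, eq_comm] at this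

theorem mem_normalizer_closure {t : G} {S : Set G} (ht : t ^ 2 = 1)
    (hconj : ∀ s ∈ S, t * s * t⁻¹ ∈ Subgroup.closure S) :
    t ∈ Subgroup.normalizer (Subgroup.closure S : Set G) := by
  refine Subgroup.zpowers_le.1 (Subgroup.le_normalizer_closure_iff.2 fun y hy s hs => ?_)
  rcases eq_one_or_eq_of_mem_zpowers ht hy with rfl | rfl
  · simpa using Subgroup.subset_closure hs
  · exact hconj s hs

end Involutions

section Card

theorem card_sup_eq_mul {N H : Subgroup G} (hnorm : H ≤ Subgroup.normalizer (N : Set G))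
    (hdisj : Disjoint N H) : Nat.card ↥(N ⊔ H) = Nat.card N * Nat.card H := by
  have hrange : Set.range (fun g : N × H => (g.1 * g.2 : G)) = ↑(N ⊔ H) := by
    rw [Subgroup.coe_mul_of_right_le_normalizer_left N H hnorm]
    ext x
    simp [Set.mem_mul]
  rw [← Nat.card_prod]
  exact Nat.card_congr <| (Equiv.setCongr hrange.symm).trans
    (Equiv.ofInjective _ (Subgroup.mul_injective_of_disjoint hdisj)).symm

theorem card_closure_insert {t : G} {S : Set G} (ht : t ^ 2 = 1)
    (hconj : ∀ s ∈ S, t * s * t⁻¹ ∈ Subgroup.closure S) (hmem : t ∉ Subgroup.closure S) :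
    Nat.card (Subgroup.closure (insert t S)) = 2 * Nat.card (Subgroup.closure S) := by
  have hdisj : Disjoint (Subgroup.closure S) (Subgroup.zpowers t) := by
    refine Subgroup.disjoint_def.2 fun hx hxt => ?_
    rcases eq_one_or_eq_of_mem_zpowers ht hxt with rfl | rfl
    exacts [rfl, absurd hx hmem]
  have ht1 : t ≠ 1 := fun h => hmem (h ▸ one_mem _)
  rw [Set.insert_eq, Subgroup.closure_union, ← Subgroup.zpowers_eq_closure, sup_comm,
    card_sup_eq_mul (Subgroup.zpowers_le.2 (mem_normalizer_closure ht hconj)) hdisj,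
    Nat.card_zpowers, orderOf_eq_prime ht ht1, mul_comm]

theorem card_closure_pair_of_involutions {b c : G} (hb : orderOf b = 2) (hc : orderOf c = 2) :
    Nat.card (Subgroup.closure {b, c}) = 2 * orderOf (b * c) := by
  have hb2 : b ^ 2 = 1 := hb ▸ pow_orderOf_eq_one b
  have hc2 : c ^ 2 = 1 := hc ▸ pow_orderOf_eq_one c
  have hb1 : b ≠ 1 := by rintro rfl; simp at hb
  have hc1 : c ≠ 1 := by rintro rfl; simp at hc
  have hrot : Subgroup.closure {b, c} = Subgroup.closure {b, b * c} := by
    refine le_antisymm ?_ ?_ <;> rw [Subgroup.closure_le, Set.pair_subset_iff] <;>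
      refine ⟨Subgroup.subset_closure (by simp), ?_⟩
    · simpa using mul_mem (inv_mem (Subgroup.subset_closure (by simp : b ∈ {b, b * c})))
        (Subgroup.subset_closure (by simp : b * c ∈ {b, b * c}))
    · exact mul_mem (Subgroup.subset_closure (by simp)) (Subgroup.subset_closure (by simp))
  have hmem : b ∉ Subgroup.zpowers (b * c) := by
    intro h
    -- A rotation commutes with `b * c`, whereas `b` inverts it.
    have hcomm : Commute b c := by
      obtain ⟨k, hk⟩ := h
      have := (Commute.refl (b * c)).zpow_left k
      rw [show (b * c) ^ k = b from hk] at this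
      simpa using (Commute.refl b).inv_right.mul_right this
    have hbc2 : (b * c) ^ 2 = 1 := by rw [hcomm.mul_pow, hb2, hc2, one_mul]
    rcases eq_one_or_eq_of_mem_zpowers hbc2 h with h | h
    · exact hb1 h
    · exact hc1 (left_eq_mul.1 h)
  rw [hrot, card_closure_insert hb2, ← Subgroup.zpowers_eq_closure, Nat.card_zpowers]
  · rintro _ rfl
    have : b * (b * c) * b⁻¹ = (b * c)⁻¹ := by
      rw [← mul_assoc, ← pow_two, hb2, one_mul, mul_inv_rev, inv_eq_self_of_sq_eq_one hc2]
    exact this ▸ inv_mem (Subgroup.subset_closure rfl)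
  · rwa [← Subgroup.zpowers_eq_closure]

/-- The first `r` permutations `σ i` act triangularly on the points `p i`: each `p j` is moved by
`σ j` but fixed by all earlier `σ i`. This certifies that the `σ i` are independent. -/
def IsTriangular {X : Type*} (σ : ℕ → Equiv.Perm X) (p : ℕ → X) (r : ℕ) : Prop :=
  ∀ j < r, (∀ i < j, σ i (p j) = p j) ∧ σ j (p j) ≠ p j

theorem card_closure_image_Iio {X : Type*} (θ : G →* Equiv.Perm X) {g : ℕ → G} {p : ℕ → X} {r : ℕ}
    (hsq : ∀ i < r, g i ^ 2 = 1) (hcomm : ∀ j < r, ∀ i < j, Commute (g i) (g j))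
    (hp : IsTriangular (θ ∘ g) p r) :
    Nat.card (Subgroup.closure (g '' Set.Iio r)) = 2 ^ r := by
  induction r with
  | zero => simp
  | succ r ih =>
    have hr := r.lt_succ_self
    have hnot : g r ∉ Subgroup.closure (g '' Set.Iio r) := by
      have hstab : Subgroup.closure (g '' Set.Iio r) ≤
          (MulAction.stabilizer (Equiv.Perm X) (p r)).comap θ := by
        rw [Subgroup.closure_le]
        rintro _ ⟨i, hi, rfl⟩
        exact (hp r hr).1 i hi
      exact fun h => (hp r hr).2 (hstab h)
    have hconj : ∀ s ∈ g '' Set.Iio r, g r * s * (g r)⁻¹ ∈ Subgroup.closure (g '' Set.Iio r) := by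
      rintro _ ⟨i, hi, rfl⟩
      rw [(hcomm r hr i hi).eq.symm, mul_inv_cancel_right]
      exact Subgroup.subset_closure ⟨i, hi, rfl⟩
    rw [← Order.succ_eq_add_one, Order.Iio_succ_eq_insert, Set.image_insert_eq,
      card_closure_insert (hsq r hr) hconj hnot, Order.succ_eq_add_one, pow_succ',
      ih (fun i hi => hsq i (by lia)) (fun j hj => hcomm j (by lia)) (fun j hj => hp j (by lia))]

end Card

section Intersection

variable {d : ℕ}

theorem parabolic_mono (ρ : Fin d → G) {I J : Set (Fin d)} (hIJ : I ⊆ J) :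
    parabolic ρ I ≤ parabolic ρ J :=
  Subgroup.closure_mono (Set.image_mono hIJ)

theorem gen_mem_parabolic (ρ : Fin d → G) {I : Set (Fin d)} {i : Fin d} (hi : i ∈ I) :
    ρ i ∈ parabolic ρ I :=
  Subgroup.subset_closure ⟨i, hi, rfl⟩

theorem parabolic_singleton (ρ : Fin d → G) (i : Fin d) :
    parabolic ρ {i} = Subgroup.zpowers (ρ i) := by
  rw [parabolic, Set.image_singleton, Subgroup.zpowers_eq_closure]

theorem eq_one_or_eq_of_mem_parabolic_singleton {ρ : Fin d → G} {i : Fin d} (hi : ρ i ^ 2 = 1)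
    {x : G} (hx : x ∈ parabolic ρ {i}) : x = 1 ∨ x = ρ i :=
  eq_one_or_eq_of_mem_zpowers hi (parabolic_singleton ρ i ▸ hx)

theorem mem_of_gen_mem_parabolic {ρ : Fin d → G} (hρ : ∀ i, orderOf (ρ i) = 2)
    (hinj : Function.Injective ρ) {I : Set (Fin d)} {i k : Fin d} (hI : I ⊆ {i, k}) (hi : i ∈ I)
    (hk : ρ k ∈ parabolic ρ I) : k ∈ I := by
  by_contra hkI
  have hIi : I ⊆ {i} := fun l hl => (hI hl).resolve_right fun h => hkI (h ▸ hl)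
  rcases eq_one_or_eq_of_mem_parabolic_singleton (hρ i ▸ pow_orderOf_eq_one (ρ i))
    (parabolic_mono ρ hIi hk) with h | h
  · simpa [h] using hρ k
  · exact hkI (hinj h ▸ hi)

theorem exists_zpow_mul_zpow_of_mem_parabolic {ρ : Fin d → G} {i j : Fin d}
    (hij : Commute (ρ i) (ρ j)) {x : G} (hx : x ∈ parabolic ρ {i, j}) :
    ∃ m n : ℤ, ρ i ^ m * ρ j ^ n = x := by
  have hnorm : Subgroup.zpowers (ρ i) ≤ Subgroup.normalizer (Subgroup.zpowers (ρ j) : Set G) := by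
    refine le_trans ?_ (Subgroup.centralizer_le_normalizer _)
    rw [Subgroup.zpowers_le, Subgroup.mem_centralizer_iff]
    rintro _ ⟨n, rfl⟩
    exact (hij.zpow_right n).symm.eq
  rw [parabolic, Set.image_pair, Set.insert_eq, Subgroup.closure_union,
    ← Subgroup.zpowers_eq_closure, ← Subgroup.zpowers_eq_closure, ← SetLike.mem_coe,
    Subgroup.coe_mul_of_left_le_normalizer_right _ _ hnorm] at hx
  obtain ⟨_, ⟨m, rfl⟩, _, ⟨n, rfl⟩, rfl⟩ := hx
  exact ⟨m, n, rfl⟩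

/-- `ε` is a retraction of `G` onto the parabolic subgroup `G_K` that kills the generators
outside `K`. -/
structure IsParabolicRetraction (ε : G →* G) (ρ : Fin d → G) (K : Set (Fin d)) : Prop where
  map_of_mem : ∀ i ∈ K, ε (ρ i) = ρ i
  map_of_notMem : ∀ i ∉ K, ε (ρ i) = 1

namespace IsParabolicRetraction

variable {ε : G →* G} {ρ : Fin d → G} {K : Set (Fin d)} (hε : IsParabolicRetraction ε ρ K)
include hε

theorem map_mem {I : Set (Fin d)} {x : G} (hx : x ∈ parabolic ρ I) :
    ε x ∈ parabolic ρ (K ∩ I) := by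
  suffices parabolic ρ I ≤ (parabolic ρ (K ∩ I)).comap ε from this hx
  rw [parabolic, Subgroup.closure_le]
  rintro _ ⟨i, hi, rfl⟩
  rw [SetLike.mem_coe, Subgroup.mem_comap]
  by_cases hK : i ∈ K
  · rw [hε.map_of_mem i hK]
    exact gen_mem_parabolic ρ ⟨hK, hi⟩
  · rw [hε.map_of_notMem i hK]
    exact one_mem _

theorem map_eq_self {x : G} (hx : x ∈ parabolic ρ K) : ε x = x := by
  refine MonoidHom.eqOn_closure (f := ε) (g := MonoidHom.id G) ?_ hx
  rintro _ ⟨i, hi, rfl⟩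
  exact hε.map_of_mem i hi

theorem inf_parabolic_le (I : Set (Fin d)) :
    parabolic ρ K ⊓ parabolic ρ I ≤ parabolic ρ (K ∩ I) :=
  fun _ hx => hε.map_eq_self hx.1 ▸ hε.map_mem hx.2

end IsParabolicRetraction

variable {ρ : Fin 3 → G}

theorem parabolic_inf_parabolic_of_compl (hρ : ∀ i, orderOf (ρ i) = 2)
    (hinj : Function.Injective ρ)
    (hmax : ∀ i j, i < j → parabolic ρ {i}ᶜ ⊓ parabolic ρ {j}ᶜ ≤ parabolic ρ ({i}ᶜ ∩ {j}ᶜ))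
    (I J : Set (Fin 3)) : parabolic ρ I ⊓ parabolic ρ J = parabolic ρ (I ∩ J) := by
  refine le_antisymm ?_ (le_inf (parabolic_mono ρ Set.inter_subset_left)
    (parabolic_mono ρ Set.inter_subset_right))
  by_cases hIJ : I ⊆ J
  · rw [Set.inter_eq_left.2 hIJ]; exact inf_le_left
  by_cases hJI : J ⊆ I
  · rw [Set.inter_eq_right.2 hJI]; exact inf_le_right
  obtain ⟨i, hiI, hiJ⟩ := Set.not_subset.1 hIJ
  obtain ⟨j, hjJ, hjI⟩ := Set.not_subset.1 hJI
  have hij : i ≠ j := fun h => hiJ (h ▸ hjJ)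
  have hmax_ij : parabolic ρ {i}ᶜ ⊓ parabolic ρ {j}ᶜ ≤ parabolic ρ ({i}ᶜ ∩ {j}ᶜ) := by
    rcases lt_or_gt_of_ne hij with h | h
    · exact hmax i j h
    · rw [inf_comm, Set.inter_comm]
      exact hmax j i h
  have third : ∀ i j : Fin 3, i ≠ j → ∃ k, ∀ l, l = i ∨ l = j ∨ l = k := by decide
  obtain ⟨k, hk⟩ := third i j hij
  rintro x ⟨hxI, hxJ⟩
  have hxk : x ∈ parabolic ρ {k} :=
    parabolic_mono ρ (fun l hl => ((hk l).resolve_left hl.1).resolve_left hl.2)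
      (hmax_ij ⟨parabolic_mono ρ (Set.subset_compl_singleton_iff.2 hiJ) hxJ,
        parabolic_mono ρ (Set.subset_compl_singleton_iff.2 hjI) hxI⟩)
  rcases eq_one_or_eq_of_mem_parabolic_singleton (hρ k ▸ pow_orderOf_eq_one (ρ k)) hxk
    with rfl | rfl
  · exact one_mem _
  have hIik : I ⊆ {i, k} := fun l hl => (hk l).imp_right fun h =>
    h.resolve_left fun h => hjI (h ▸ hl)
  have hJjk : J ⊆ {j, k} := fun l hl => (hk l).resolve_left fun h => hiJ (h ▸ hl)
  exact gen_mem_parabolic ρ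
    ⟨mem_of_gen_mem_parabolic hρ hinj hIik hiI hxI, mem_of_gen_mem_parabolic hρ hinj hJjk hjJ hxJ⟩

theorem parabolic_inf_parabolic_le_of_retraction {ε : G →* G}
    (hε : IsParabolicRetraction ε ρ {0}ᶜ) (hρ : ∀ i, orderOf (ρ i) = 2)
    (hac : Commute (ρ 0) (ρ 2)) (hbc : ρ 1 ≠ ρ 2) :
    parabolic ρ {1}ᶜ ⊓ parabolic ρ {2}ᶜ ≤ parabolic ρ {0} := by
  rintro x ⟨hx₁, hx₂⟩
  have map_eq_one_or (i : Fin 3) {I : Set (Fin 3)} (hI : {0}ᶜ ∩ I ⊆ {i})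
      (hx : x ∈ parabolic ρ I) : ε x = 1 ∨ ε x = ρ i :=
    eq_one_or_eq_of_mem_parabolic_singleton (hρ i ▸ pow_orderOf_eq_one (ρ i))
      (parabolic_mono ρ hI (hε.map_mem hx))
  have hεx : ε x = 1 := by
    rcases map_eq_one_or 1 (by intro i; fin_cases i <;> simp) hx₂ with h₁ | h₁
    · exact h₁
    rcases map_eq_one_or 2 (by intro i; fin_cases i <;> simp) hx₁ with h₂ | h₂
    exacts [h₂, absurd (h₁.symm.trans h₂) hbc]
  have hpair : ({1}ᶜ : Set (Fin 3)) = {0, 2} := by ext i; fin_cases i <;> simp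
  obtain ⟨m, n, rfl⟩ := exists_zpow_mul_zpow_of_mem_parabolic hac (hpair ▸ hx₁)
  rw [map_mul, map_zpow, map_zpow, hε.map_of_notMem 0 (by simp), hε.map_of_mem 2 (by simp),
    one_zpow, one_mul] at hεx
  rw [hεx, mul_one]
  exact zpow_mem (gen_mem_parabolic ρ (Set.mem_singleton 0)) m

theorem isStringCGroup_of_retraction {ε : G →* G}
    (hε : IsParabolicRetraction ε ρ {0}ᶜ) (hρ : ∀ i, orderOf (ρ i) = 2)
    (hgen : Subgroup.closure (Set.range ρ) = ⊤) (hac : Commute (ρ 0) (ρ 2)) (hbc : ρ 1 ≠ ρ 2) :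
    IsStringCGroup ρ := by
  have hne (i : Fin 3) (hi : i ≠ 0) : ρ i ≠ ρ 0 := fun h => by
    have : ρ i = 1 := by rw [← hε.map_of_mem i hi, h, hε.map_of_notMem 0 (by simp)]
    simpa [this] using hρ i
  have hinj : Function.Injective ρ := by
    intro i j hij
    fin_cases i <;> fin_cases j <;> first | rfl | skip
    exacts [absurd hij.symm (hne 1 (by decide)), absurd hij.symm (hne 2 (by decide)),
      absurd hij (hne 1 (by decide)), absurd hij hbc, absurd hij (hne 2 (by decide)),
      absurd hij.symm hbc]
  have hmax (i : Fin 3) := hε.inf_parabolic_le ({i}ᶜ : Set (Fin 3))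
  have h₁₂ : parabolic ρ {1}ᶜ ⊓ parabolic ρ {2}ᶜ ≤ parabolic ρ ({1}ᶜ ∩ {2}ᶜ) :=
    (parabolic_inf_parabolic_le_of_retraction hε hρ hac hbc).trans
      (parabolic_mono ρ (by simp))
  refine ⟨hρ, hgen, ?_, parabolic_inf_parabolic_of_compl hρ hinj ?_⟩
  · intro i j hij
    fin_cases i <;> fin_cases j <;> simp at hij
    exacts [hac, hac.symm]
  · intro i j hij
    fin_cases i <;> fin_cases j <;> simp at hij
    exacts [hmax 1, hmax 2, h₁₂]

end Intersection

section ConjugateSequence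

/-- The generator that conjugates the `k`-th term of `conjSeq ρ` to the next one: `ρ 1` and `ρ 2`
alternate, starting with `ρ 1`. -/
def step {α : Type*} (ρ : Fin 3 → α) (k : ℕ) : α := if Even k then ρ 1 else ρ 2

theorem step_of_even {α : Type*} (ρ : Fin 3 → α) {k : ℕ} (hk : Even k) : step ρ k = ρ 1 :=
  if_pos hk

theorem step_of_odd {α : Type*} (ρ : Fin 3 → α) {k : ℕ} (hk : Odd k) : step ρ k = ρ 2 :=
  if_neg (Nat.not_even_iff_odd.2 hk)

/-- The conjugates `ρ₀, ρ₁ρ₀ρ₁, ρ₂ρ₁ρ₀ρ₁ρ₂, ρ₁ρ₂ρ₁ρ₀ρ₁ρ₂ρ₁, …` of `ρ 0` under the elements of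
the dihedral group `⟨ρ 1, ρ 2⟩`. -/
def conjSeq (ρ : Fin 3 → G) : ℕ → G
  | 0 => ρ 0
  | k + 1 => step ρ k * conjSeq ρ k * (step ρ k)⁻¹

/-- The subgroup generated by the first `r` terms of `conjSeq ρ`. If it is normal, it is the normal
closure of `ρ 0`, the kernel of the retraction onto `⟨ρ 1, ρ 2⟩`. -/
def conjClosure (ρ : Fin 3 → G) (r : ℕ) : Subgroup G :=
  Subgroup.closure (conjSeq ρ '' Set.Iio r)

variable {ρ : Fin 3 → G} {r : ℕ}

theorem map_conjSeq {H : Type*} [Group H] (φ : G →* H) (k : ℕ) :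
    φ (conjSeq ρ k) = conjSeq (φ ∘ ρ) k := by
  induction k with
  | zero => rfl
  | succ k ih =>
    simp only [conjSeq, step, map_mul, map_inv, ih]
    split_ifs <;> rfl

theorem conjSeq_sq (hρ : ρ 0 ^ 2 = 1) (k : ℕ) : conjSeq ρ k ^ 2 = 1 := by
  induction k with
  | zero => exact hρ
  | succ k ih => rw [conjSeq, conj_pow, ih, mul_one, mul_inv_cancel]

theorem conjSeq_eq_one (hρ : ρ 0 = 1) (k : ℕ) : conjSeq ρ k = 1 := by
  induction k with
  | zero => exact hρ
  | succ k ih => rw [conjSeq, ih, mul_one, mul_inv_cancel]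

theorem conj_conjSeq_succ (hρ : ∀ i, ρ i ^ 2 = 1) (k : ℕ) :
    step ρ k * conjSeq ρ (k + 1) * (step ρ k)⁻¹ = conjSeq ρ k := by
  have : step ρ k ^ 2 = 1 := by rw [step]; split_ifs <;> exact hρ _
  rw [conjSeq, mul_assoc, mul_assoc, mul_assoc, ← mul_inv_rev, ← pow_two, this, inv_one, mul_one,
    ← mul_assoc, ← pow_two, this, one_mul]

theorem mul_sq_eq_conjSeq_mul_conjSeq (hρ : ρ 1 ^ 2 = 1) :
    (ρ 0 * ρ 1) ^ 2 = conjSeq ρ 0 * conjSeq ρ 1 := by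
  simp only [conjSeq, step_of_even ρ Even.zero, inv_eq_self_of_sq_eq_one hρ, pow_two, mul_assoc]

theorem conjSeq_mem_conjClosure {k : ℕ} (hk : k < r) : conjSeq ρ k ∈ conjClosure ρ r :=
  Subgroup.subset_closure ⟨k, hk, rfl⟩

theorem conj_conjSeq_mem_conjClosure (hρ : ∀ i, ρ i ^ 2 = 1) (hac : Commute (ρ 0) (ρ 2))
    (hcomm : ∀ k < r, Commute (ρ 0) (conjSeq ρ k)) (hmem : conjSeq ρ r ∈ conjClosure ρ r)
    (i : Fin 3) {k : ℕ} (hk : k < r) : ρ i * conjSeq ρ k * (ρ i)⁻¹ ∈ conjClosure ρ r := by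
  have up : step ρ k * conjSeq ρ k * (step ρ k)⁻¹ ∈ conjClosure ρ r := by
    rcases (Nat.succ_le_of_lt hk).lt_or_eq with hk | hk
    exacts [conjSeq_mem_conjClosure hk, hk ▸ hmem]
  have down (l : ℕ) (hl : k = l + 1) :
      step ρ l * conjSeq ρ k * (step ρ l)⁻¹ ∈ conjClosure ρ r := by
    rw [hl, conj_conjSeq_succ hρ l]
    exact conjSeq_mem_conjClosure (by lia)
  fin_cases i
  · simpa [(hcomm k hk).eq] using conjSeq_mem_conjClosure hk
  · rcases k.even_or_odd with hk | ⟨l, rfl⟩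
    · exact step_of_even ρ hk ▸ up
    · exact step_of_even ρ (even_two_mul l) ▸ down (2 * l) rfl
  · rcases k with - | l
    · simpa [conjSeq, hac.symm.eq] using conjSeq_mem_conjClosure hk
    rcases l.even_or_odd with hl | hl
    · exact step_of_odd ρ hl.add_one ▸ up
    · exact step_of_odd ρ hl ▸ down l rfl

theorem conjClosure_normal (hρ : ∀ i, ρ i ^ 2 = 1)
    (hgen : Subgroup.closure (Set.range ρ) = ⊤) (hac : Commute (ρ 0) (ρ 2))
    (hcomm : ∀ k < r, Commute (ρ 0) (conjSeq ρ k)) (hmem : conjSeq ρ r ∈ conjClosure ρ r) :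
    (conjClosure ρ r).Normal := by
  rw [← Subgroup.normalizer_eq_top_iff, eq_top_iff, ← hgen, Subgroup.closure_le]
  rintro _ ⟨i, rfl⟩
  refine mem_normalizer_closure (hρ i) ?_
  rintro _ ⟨k, hk, rfl⟩
  exact conj_conjSeq_mem_conjClosure hρ hac hcomm hmem i hk

theorem IsParabolicRetraction.disjoint_conjClosure {ε : G →* G}
    (hε : IsParabolicRetraction ε ρ {0}ᶜ) (r : ℕ) :
    Disjoint (conjClosure ρ r) (parabolic ρ {0}ᶜ) := by
  have hker : conjClosure ρ r ≤ ε.ker := by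
    rw [conjClosure, Subgroup.closure_le]
    rintro _ ⟨k, -, rfl⟩
    rw [SetLike.mem_coe, MonoidHom.mem_ker, map_conjSeq]
    exact conjSeq_eq_one (hε.map_of_notMem 0 (by simp)) k
  exact Subgroup.disjoint_def.2 fun hxN hxK => (hε.map_eq_self hxK).symm.trans (hker hxN)

theorem conjClosure_sup_parabolic (hr : 0 < r) (hgen : Subgroup.closure (Set.range ρ) = ⊤) :
    conjClosure ρ r ⊔ parabolic ρ {0}ᶜ = ⊤ := by
  rw [eq_top_iff, ← hgen, Subgroup.closure_le]
  rintro _ ⟨i, rfl⟩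
  rcases eq_or_ne i 0 with rfl | hi
  exacts [Subgroup.mem_sup_left (conjSeq_mem_conjClosure hr),
    Subgroup.mem_sup_right (gen_mem_parabolic ρ hi)]

theorem card_parabolic_compl_zero (hρ : ∀ i, orderOf (ρ i) = 2) :
    Nat.card (parabolic ρ {0}ᶜ) = 2 * orderOf (ρ 1 * ρ 2) := by
  have : ({0}ᶜ : Set (Fin 3)) = {1, 2} := by ext i; fin_cases i <;> simp
  rw [parabolic, this, Set.image_pair, card_closure_pair_of_involutions (hρ 1) (hρ 2)]

theorem card_eq_card_conjClosure_mul {ε : G →* G} (hε : IsParabolicRetraction ε ρ {0}ᶜ)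
    (hρ : ∀ i, orderOf (ρ i) = 2) (hgen : Subgroup.closure (Set.range ρ) = ⊤) (hr : 0 < r)
    (hnormal : (conjClosure ρ r).Normal) :
    Nat.card G = Nat.card (conjClosure ρ r) * (2 * orderOf (ρ 1 * ρ 2)) := by
  rw [← Subgroup.card_top, ← conjClosure_sup_parabolic hr hgen,
    card_sup_eq_mul Subgroup.le_normalizer_of_normal (hε.disjoint_conjClosure r),
    card_parabolic_compl_zero hρ]

end ConjugateSequence

section Presentation

/-- The images `ρ` of the free generators satisfy all relations `w = 1` with `w ∈ baseRels t`. -/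
structure SatisfiesBaseRels (t : ℕ) (ρ : Fin 3 → G) : Prop where
  sq : ∀ i, ρ i ^ 2 = 1
  pow_four : (ρ 0 * ρ 1) ^ 4 = 1
  pow_two_pow : (ρ 1 * ρ 2) ^ 2 ^ t = 1
  sq_mul : (ρ 0 * ρ 2) ^ 2 = 1

theorem lift_baseRels_iff {t : ℕ} {ρ : Fin 3 → G} :
    (∀ w ∈ baseRels t, FreeGroup.lift ρ w = 1) ↔ SatisfiesBaseRels t ρ := by
  have : (∀ w ∈ baseRels t, FreeGroup.lift ρ w = 1) ↔ (∀ i, ρ i ^ 2 = 1) ∧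
      (ρ 0 * ρ 1) ^ 4 = 1 ∧ (ρ 1 * ρ 2) ^ 2 ^ t = 1 ∧ (ρ 0 * ρ 2) ^ 2 = 1 := by
    simp only [baseRels, Nat.reducePow, Set.mem_insert_iff, Set.mem_singleton_iff,
      forall_eq_or_imp, map_pow, FreeGroup.lift_apply_of, map_mul, forall_eq, Fin.forall_fin_succ,
      Fin.succ_zero_eq_one, Fin.succ_one_eq_two, IsEmpty.forall_iff, and_true]
    tauto
  exact this.trans ⟨fun ⟨h₁, h₂, h₃, h₄⟩ => ⟨h₁, h₂, h₃, h₄⟩,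
    fun ⟨h₁, h₂, h₃, h₄⟩ => ⟨h₁, h₂, h₃, h₄⟩⟩

namespace SatisfiesBaseRels

variable {t : ℕ} {ρ : Fin 3 → G}

theorem mono {s : ℕ} (h : SatisfiesBaseRels s ρ) (hst : s ≤ t) : SatisfiesBaseRels t ρ where
  sq := h.sq
  pow_four := h.pow_four
  pow_two_pow := orderOf_dvd_iff_pow_eq_one.1 <|
    (orderOf_dvd_of_pow_eq_one h.pow_two_pow).trans (pow_dvd_pow 2 hst)
  sq_mul := h.sq_mul

theorem commute (h : SatisfiesBaseRels t ρ) : Commute (ρ 0) (ρ 2) :=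
  commute_of_sq_mul_eq_one (h.sq 0) (h.sq 2) h.sq_mul

theorem kill_zero (h : SatisfiesBaseRels t ρ) : SatisfiesBaseRels t ![1, ρ 1, ρ 2] where
  sq i := by fin_cases i; exacts [one_pow 2, h.sq 1, h.sq 2]
  pow_four := by simp [pow_mul (ρ 1) 2 2, h.sq 1]
  pow_two_pow := h.pow_two_pow
  sq_mul := by simp [h.sq 2]

end SatisfiesBaseRels

open DihedralGroup in
theorem satisfiesBaseRels_dihedral (t : ℕ) :
    SatisfiesBaseRels t ![1, sr 0, (sr 1 : DihedralGroup (2 ^ t))] where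
  sq i := by fin_cases i <;> simp [pow_two]
  pow_four := by simp [pow_succ]
  pow_two_pow := by simp
  sq_mul := by simp [pow_two]

theorem lift_gen_eq_one {R : Set (FreeGroup (Fin 3))} {w : FreeGroup (Fin 3)} (hw : w ∈ R) :
    FreeGroup.lift (gen R) w = 1 := by
  have : FreeGroup.lift (gen R) = PresentedGroup.mk R := by
    ext i
    simp [gen, PresentedGroup.of]
  rw [this]
  exact PresentedGroup.one_of_mem hw

theorem exists_hom {R : Set (FreeGroup (Fin 3))} {f : Fin 3 → G}
    (hf : ∀ w ∈ R, FreeGroup.lift f w = 1) : ∃ φ : PresentedGroup R →* G, ∀ i, φ (gen R i) = f i :=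
  ⟨PresentedGroup.toGroup hf, fun _ => PresentedGroup.toGroup.of hf⟩

/-- Modulo `ρ 0`, the relators in `R` follow from those in `baseRels t`; the group presented by `R`
then collapses to the dihedral group of order `2 ^ (t + 1)` when `ρ 0` is killed. -/
def CollapsesToDihedral (R : Set (FreeGroup (Fin 3))) (t : ℕ) : Prop :=
  ∀ ⦃H : Type⦄ [Group H] ⦃f : Fin 3 → H⦄, f 0 = 1 → SatisfiesBaseRels t f →
    ∀ w ∈ R, FreeGroup.lift f w = 1

variable {R : Set (FreeGroup (Fin 3))} {t : ℕ}

theorem CollapsesToDihedral.exists_retraction (hR : CollapsesToDihedral R t)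
    (hbase : SatisfiesBaseRels t (gen R)) :
    ∃ ε, IsParabolicRetraction ε (gen R) {0}ᶜ := by
  obtain ⟨ε, hε⟩ := exists_hom (hR rfl hbase.kill_zero)
  refine ⟨ε, fun i hi => ?_, fun i hi => ?_⟩
  · fin_cases i
    exacts [absurd rfl hi, hε 1, hε 2]
  · rw [Set.notMem_compl_iff, Set.mem_singleton_iff] at hi
    exact hi ▸ hε 0

open DihedralGroup in
theorem CollapsesToDihedral.orderOf_rotation (hR : CollapsesToDihedral R t)
    (hbase : SatisfiesBaseRels t (gen R)) : orderOf (gen R 1 * gen R 2) = 2 ^ t := by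
  obtain ⟨δ, hδ⟩ := exists_hom (hR rfl (satisfiesBaseRels_dihedral t))
  refine Nat.dvd_antisymm (orderOf_dvd_of_pow_eq_one hbase.pow_two_pow) ?_
  have hrot : δ (gen R 1 * gen R 2) = r 1 := by simp [hδ]
  rw [← orderOf_r_one (n := 2 ^ t), ← hrot]
  exact orderOf_map_dvd δ _

open DihedralGroup in
theorem CollapsesToDihedral.orderOf_reflection (hR : CollapsesToDihedral R t)
    (hbase : SatisfiesBaseRels t (gen R)) {i : Fin 3} (hi : i ≠ 0) : orderOf (gen R i) = 2 := by
  obtain ⟨δ, hδ⟩ := exists_hom (hR rfl (satisfiesBaseRels_dihedral t))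
  have hne : (![1, sr 0, sr 1] : Fin 3 → DihedralGroup (2 ^ t)) i ≠ 1 := by
    fin_cases i
    exacts [absurd rfl hi, nofun, nofun]
  exact orderOf_eq_prime (hbase.sq i) fun h => hne (by rw [← hδ, h, map_one])

end Presentation

section Criterion

variable {R : Set (FreeGroup (Fin 3))} {t r : ℕ}

theorem orderOf_eq_of_isTriangular {ρ : Fin 3 → G} {X : Type*} (θ : G →* Equiv.Perm X)
    {p : ℕ → X} (hp : IsTriangular (θ ∘ conjSeq ρ) p r) (hr : 2 ≤ r)
    (hbase : SatisfiesBaseRels t ρ) : orderOf (ρ 0) = 2 ∧ orderOf (ρ 0 * ρ 1) = 4 := by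
  refine ⟨orderOf_eq_prime (hbase.sq 0) fun h => ?_,
    orderOf_eq_prime_pow (p := 2) (n := 1) ?_ hbase.pow_four⟩
  · exact (hp 0 (by lia)).2 (by simp [conjSeq, h])
  · rw [pow_one, mul_sq_eq_conjSeq_mul_conjSeq (hbase.sq 1), mul_eq_one_iff_eq_inv]
    intro h
    obtain ⟨hfix, hmove⟩ := hp 1 (by lia)
    refine hmove ?_
    have := hfix 0 one_pos
    rwa [Function.comp_apply, h, map_inv, Equiv.Perm.inv_eq_iff_eq, eq_comm] at this

theorem isStringCGroup_card_hasSchlafliType (hbase : SatisfiesBaseRels t (gen R)) (ht : 1 ≤ t)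
    (hR : CollapsesToDihedral R t) (hr : 2 ≤ r)
    (hcomm : ∀ j < r, ∀ i < j, Commute (conjSeq (gen R) i) (conjSeq (gen R) j))
    (hmem : conjSeq (gen R) r ∈ conjClosure (gen R) r)
    {X : Type*} {f : Fin 3 → Equiv.Perm X} (hf : ∀ w ∈ R, FreeGroup.lift f w = 1)
    {p : ℕ → X} (hp : IsTriangular (conjSeq f) p r) :
    IsStringCGroup (gen R) ∧ Nat.card (PresentedGroup R) = 2 ^ (r + t + 1) ∧
      HasSchlafliType (gen R) ![4, 2 ^ t] := by
  obtain ⟨ε, hε⟩ := hR.exists_retraction hbase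
  obtain ⟨θ, hθ⟩ := exists_hom hf
  have hpθ : IsTriangular (θ ∘ conjSeq (gen R)) p r := by
    rwa [show θ ∘ conjSeq (gen R) = conjSeq f by
      ext k : 1; rw [Function.comp_apply, map_conjSeq]; congr 1; exact funext hθ]
  obtain ⟨hord₀, hord₀₁⟩ := orderOf_eq_of_isTriangular θ hpθ hr hbase
  have hord₁₂ := hR.orderOf_rotation hbase
  have hord (i : Fin 3) : orderOf (gen R i) = 2 := by
    rcases eq_or_ne i 0 with rfl | hi
    exacts [hord₀, hR.orderOf_reflection hbase hi]
  have hgen : Subgroup.closure (Set.range (gen R)) = ⊤ := PresentedGroup.closure_range_of R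
  have hne : gen R 1 ≠ gen R 2 := fun h => by
    rw [h, ← pow_two, hbase.sq 2, orderOf_one] at hord₁₂
    exact (Nat.one_lt_two_pow (by lia : t ≠ 0)).ne hord₁₂
  have hzero (k : ℕ) (hk : k < r) : Commute (gen R 0) (conjSeq (gen R) k) := by
    rcases k.eq_zero_or_pos with rfl | hpos
    exacts [Commute.refl _, hcomm k hk 0 hpos]
  have hnormal := conjClosure_normal hbase.sq hgen hbase.commute hzero hmem
  refine ⟨isStringCGroup_of_retraction hε hord hgen hbase.commute hne, ?_, ?_⟩
  · rw [card_eq_card_conjClosure_mul hε hord hgen (by lia) hnormal, hord₁₂, conjClosure,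
      card_closure_image_Iio θ (fun k _ => conjSeq_sq (hbase.sq 0) k) hcomm hpθ]
    ring
  · intro i
    fin_cases i
    exacts [hord₀₁, hord₁₂]

end Criterion

section SignedPermutations

/-- The involutions `ρ 0`, `ρ 1`, `ρ 2` as signed permutations of the points `(i, ±)`: `ρ 0` changes
the signs at the `i` with `s i`, while `ρ 1` and `ρ 2` permute the `i` by `β` and `γ`. -/
def signedPerm {ι : Type*} (s : ι → Bool) (β γ : Equiv.Perm ι) : Fin 3 → Equiv.Perm (ι × Bool) :=
  ![(Equiv.refl ι).prodShear fun i => if s i then Equiv.boolNot else Equiv.refl Bool,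
    β.prodCongr (Equiv.refl Bool), γ.prodCongr (Equiv.refl Bool)]

/-- A signed-permutation quotient of `G₁` on two coordinates, in which the sign changes
`conjSeq model₁ 0` and `conjSeq model₁ 1` of the single coordinates are independent. -/
def model₁ : Fin 3 → Equiv.Perm (Fin 2 × Bool) :=
  signedPerm (fun i => i = 0) (Equiv.swap 0 1) 1

/-- A signed-permutation quotient of `G₃` on four coordinates. Since
`conjSeq ρ 1 * conjSeq ρ 3 = conjSeq ρ 2 * conjSeq ρ 0` in `G₃`, the conjugates of `ρ 0` are chosen
as the sign changes on `{0, 3}`, `{0, 1}`, `{2, 3}` and `{1, 2}`, whose product is trivial. -/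
def model₃ : Fin 3 → Equiv.Perm (Fin 4 × Bool) :=
  signedPerm (fun i => i = 0 ∨ i = 3) (Equiv.swap 1 3) (Equiv.swap 0 3 * Equiv.swap 1 2)

/-- A signed-permutation quotient of `G₅` on four coordinates, in which `conjSeq model₅ k` changes
the sign of the coordinate `k` for `k < 4`. -/
def model₅ : Fin 3 → Equiv.Perm (Fin 4 × Bool) :=
  signedPerm (fun i => i = 0) (Equiv.swap 0 1 * Equiv.swap 2 3) (Equiv.swap 1 2)

theorem satisfiesBaseRels_model₁ : SatisfiesBaseRels 1 model₁ where
  sq := by decide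
  pow_four := by decide
  pow_two_pow := by decide
  sq_mul := by decide

theorem satisfiesBaseRels_model₃ : SatisfiesBaseRels 2 model₃ where
  sq := by decide
  pow_four := by decide
  pow_two_pow := by decide
  sq_mul := by decide

theorem satisfiesBaseRels_model₅ : SatisfiesBaseRels 2 model₅ where
  sq := by decide
  pow_four := by decide
  pow_two_pow := by decide
  sq_mul := by decide

theorem isTriangular_model₁ : IsTriangular (conjSeq model₁) (fun j => (Fin.ofNat 2 j, true)) 2 := by
  unfold IsTriangular; decide

theorem isTriangular_model₃ : IsTriangular (conjSeq model₃) (fun j => (Fin.ofNat 4 j, true)) 3 := by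
  unfold IsTriangular; decide

theorem isTriangular_model₅ : IsTriangular (conjSeq model₅) (fun j => (Fin.ofNat 4 j, true)) 4 := by
  unfold IsTriangular; decide

end SignedPermutations

section Relators

theorem comm_eq_one_iff {x y : G} : comm x y = 1 ↔ Commute x y := by
  rw [comm, mul_assoc, ← mul_inv_rev, inv_mul_eq_one, commute_iff_eq, eq_comm]

theorem comm_sq_eq_one_iff {x y : G} (hx : x ^ 2 = 1) :
    comm x y ^ 2 = 1 ↔ Commute x (y⁻¹ * x * y) := by
  have hcomm : comm x y = x * (y⁻¹ * x * y) := by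
    rw [comm, inv_eq_self_of_sq_eq_one hx]
    simp only [mul_assoc]
  have hconj : (y⁻¹ * x * y) ^ 2 = 1 := by
    simpa [hx] using conj_pow (a := y⁻¹) (b := x) (i := 2)
  rw [hcomm]
  exact ⟨commute_of_sq_mul_eq_one hx hconj, fun h => by rw [h.mul_pow, hx, hconj, one_mul]⟩

variable {f : Fin 3 → G} {n : ℕ}

theorem lift_rels₁_iff : (∀ w ∈ rels₁ n, FreeGroup.lift f w = 1) ↔
    SatisfiesBaseRels (n - 3) f ∧ Commute ((f 0 * f 1) ^ 2) (f 2) := by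
  rw [rels₁, ← lift_baseRels_iff, ← comm_eq_one_iff]
  simp [or_imp, forall_and, comm, and_comm]

theorem lift_rels₃_iff : (∀ w ∈ rels₃ n, FreeGroup.lift f w = 1) ↔
    SatisfiesBaseRels (n - 4) f ∧ Commute ((f 0 * f 1) ^ 2) ((f 1 * f 2) ^ 2) := by
  rw [rels₃, ← lift_baseRels_iff, ← comm_eq_one_iff]
  simp [or_imp, forall_and, comm, and_comm]

theorem lift_rels₅_iff : (∀ w ∈ rels₅ n, FreeGroup.lift f w = 1) ↔
    SatisfiesBaseRels (n - 5) f ∧ comm (f 0) ((f 1 * f 2) ^ 2) ^ 2 = 1 ∧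
      Commute (f 0) ((f 1 * f 2) ^ 4) := by
  rw [rels₅, ← lift_baseRels_iff, ← comm_eq_one_iff, and_rotate]
  simp [or_imp, forall_and, comm]

theorem collapsesToDihedral_rels₁ (n : ℕ) : CollapsesToDihedral (rels₁ n) (n - 3) := by
  intro H _ f h₀ hf
  exact lift_rels₁_iff.2 ⟨hf, by rw [h₀, one_mul, hf.sq 1]; exact Commute.one_left _⟩

theorem collapsesToDihedral_rels₃ (n : ℕ) : CollapsesToDihedral (rels₃ n) (n - 4) := by
  intro H _ f h₀ hf
  exact lift_rels₃_iff.2 ⟨hf, by rw [h₀, one_mul, hf.sq 1]; exact Commute.one_left _⟩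

theorem collapsesToDihedral_rels₅ (n : ℕ) : CollapsesToDihedral (rels₅ n) (n - 5) := by
  intro H _ f h₀ hf
  exact lift_rels₅_iff.2 ⟨hf, by simp [h₀, comm], h₀ ▸ Commute.one_left _⟩

theorem lift_model₁ (hn : 4 ≤ n) : ∀ w ∈ rels₁ n, FreeGroup.lift model₁ w = 1 :=
  lift_rels₁_iff.2 ⟨satisfiesBaseRels_model₁.mono (by lia), by unfold Commute SemiconjBy; decide⟩

theorem lift_model₃ (hn : 6 ≤ n) : ∀ w ∈ rels₃ n, FreeGroup.lift model₃ w = 1 :=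
  lift_rels₃_iff.2 ⟨satisfiesBaseRels_model₃.mono (by lia), by unfold Commute SemiconjBy; decide⟩

theorem lift_model₅ (hn : 7 ≤ n) : ∀ w ∈ rels₅ n, FreeGroup.lift model₅ w = 1 :=
  lift_rels₅_iff.2 ⟨satisfiesBaseRels_model₅.mono (by lia),
    (comm_sq_eq_one_iff (satisfiesBaseRels_model₅.sq 0)).2 (by unfold Commute SemiconjBy; decide),
    by unfold Commute SemiconjBy; decide⟩

end Relators

section ConjugateRelations

variable {ρ : Fin 3 → G} {t : ℕ}

theorem commute_conjSeq_succ_succ {i j : ℕ} (hij : step ρ i = step ρ j) :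
    Commute (conjSeq ρ (i + 1)) (conjSeq ρ (j + 1)) ↔ Commute (conjSeq ρ i) (conjSeq ρ j) := by
  rw [conjSeq, conjSeq, hij, Commute.conj_iff]

theorem commute_conjSeq_succ_left (hρ : ∀ i, ρ i ^ 2 = 1) {i j : ℕ} (hij : step ρ i = step ρ j) :
    Commute (conjSeq ρ (i + 1)) (conjSeq ρ j) ↔ Commute (conjSeq ρ i) (conjSeq ρ (j + 1)) := by
  rw [← conj_conjSeq_succ hρ j, conjSeq, hij, Commute.conj_iff]

theorem conj_eq_inv_conj_of_commute_sq {x y : G} (h : Commute x (y ^ 2)) :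
    y * x * y⁻¹ = y⁻¹ * x * y := by
  rw [mul_inv_eq_iff_eq_mul, mul_assoc, mul_assoc, eq_inv_mul_iff_mul_eq, ← mul_assoc, ← pow_two,
    h.eq]

namespace SatisfiesBaseRels

variable (h : SatisfiesBaseRels t ρ)
include h

theorem conj_two_conjSeq_zero : ρ 2 * conjSeq ρ 0 * (ρ 2)⁻¹ = conjSeq ρ 0 :=
  mul_inv_eq_iff_eq_mul.2 h.commute.symm.eq

theorem commute_conjSeq_zero_one : Commute (conjSeq ρ 0) (conjSeq ρ 1) := by
  refine commute_of_sq_mul_eq_one (conjSeq_sq (h.sq 0) 0) (conjSeq_sq (h.sq 0) 1) ?_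
  rw [← mul_sq_eq_conjSeq_mul_conjSeq (h.sq 1), ← pow_mul, h.pow_four]

theorem commute_conjSeq_zero_two : Commute (conjSeq ρ 0) (conjSeq ρ 2) := by
  rw [← h.conj_two_conjSeq_zero]
  exact (Commute.conj_iff (ρ 2)).2 h.commute_conjSeq_zero_one

theorem commute_conjSeq_one_three : Commute (conjSeq ρ 1) (conjSeq ρ 3) :=
  (commute_conjSeq_succ_succ (i := 0) (j := 2) rfl).2 h.commute_conjSeq_zero_two

theorem conj_conjSeq_zero_eq_three :
    (ρ 1 * ρ 2) ^ 2 * conjSeq ρ 0 * ((ρ 1 * ρ 2) ^ 2)⁻¹ = conjSeq ρ 3 :=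
  calc (ρ 1 * ρ 2) ^ 2 * conjSeq ρ 0 * ((ρ 1 * ρ 2) ^ 2)⁻¹
    _ = ρ 1 * (ρ 2 * (ρ 1 * (ρ 2 * conjSeq ρ 0 * (ρ 2)⁻¹) * (ρ 1)⁻¹) * (ρ 2)⁻¹) * (ρ 1)⁻¹ := by
      simp only [pow_two, mul_inv_rev, mul_assoc]
    _ = conjSeq ρ 3 := by rw [h.conj_two_conjSeq_zero]; rfl

theorem inv_conj_conjSeq_zero_eq_four :
    ((ρ 1 * ρ 2) ^ 2)⁻¹ * conjSeq ρ 0 * (ρ 1 * ρ 2) ^ 2 = conjSeq ρ 4 :=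
  calc ((ρ 1 * ρ 2) ^ 2)⁻¹ * conjSeq ρ 0 * (ρ 1 * ρ 2) ^ 2
    _ = ρ 2 * (ρ 1 * (ρ 2 * (ρ 1 * conjSeq ρ 0 * (ρ 1)⁻¹) * (ρ 2)⁻¹) * (ρ 1)⁻¹) * (ρ 2)⁻¹ := by
      simp only [pow_two, mul_inv_rev, mul_assoc, inv_eq_self_of_sq_eq_one (h.sq 1),
        inv_eq_self_of_sq_eq_one (h.sq 2)]
    _ = conjSeq ρ 4 := rfl

theorem conjSeq_two_eq_of_commute (hrel : Commute ((ρ 0 * ρ 1) ^ 2) (ρ 2)) :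
    conjSeq ρ 2 = conjSeq ρ 1 := by
  rw [mul_sq_eq_conjSeq_mul_conjSeq (h.sq 1)] at hrel
  have hcomm : Commute (ρ 2) (conjSeq ρ 1) := by
    rw [← inv_mul_cancel_left (conjSeq ρ 0) (conjSeq ρ 1)]
    exact h.commute.symm.inv_right.mul_right hrel.symm
  exact mul_inv_eq_iff_eq_mul.2 hcomm.eq

theorem conjSeq_one_mul_three_eq_of_commute
    (hrel : Commute ((ρ 0 * ρ 1) ^ 2) ((ρ 1 * ρ 2) ^ 2)) :
    conjSeq ρ 1 * conjSeq ρ 3 = conjSeq ρ 2 * conjSeq ρ 0 := by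
  rw [mul_sq_eq_conjSeq_mul_conjSeq (h.sq 1)] at hrel
  have hinv : ρ 1 * ρ 2 = (ρ 2 * ρ 1)⁻¹ := by
    rw [mul_inv_rev, inv_eq_self_of_sq_eq_one (h.sq 1), inv_eq_self_of_sq_eq_one (h.sq 2)]
  calc conjSeq ρ 1 * conjSeq ρ 3
    _ = ρ 1 * (ρ 2 * conjSeq ρ 0 * (ρ 2)⁻¹) * (ρ 1)⁻¹ *
        (ρ 1 * (ρ 2 * conjSeq ρ 1 * (ρ 2)⁻¹) * (ρ 1)⁻¹) := by rw [h.conj_two_conjSeq_zero]; rfl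
    _ = (ρ 1 * ρ 2) * (conjSeq ρ 0 * conjSeq ρ 1) * (ρ 1 * ρ 2)⁻¹ := by group
    _ = (ρ 1 * ρ 2)⁻¹ * (conjSeq ρ 0 * conjSeq ρ 1) * (ρ 1 * ρ 2) :=
      conj_eq_inv_conj_of_commute_sq hrel
    _ = ρ 2 * (ρ 1 * conjSeq ρ 0 * (ρ 1)⁻¹) * (ρ 2)⁻¹ *
        (ρ 2 * (ρ 1 * conjSeq ρ 1 * (ρ 1)⁻¹) * (ρ 2)⁻¹) := by rw [hinv]; group
    _ = ρ 2 * conjSeq ρ 1 * (ρ 2)⁻¹ * (ρ 2 * conjSeq ρ 0 * (ρ 2)⁻¹) := by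
      rw [show ρ 1 * conjSeq ρ 1 * (ρ 1)⁻¹ = conjSeq ρ 0 from conj_conjSeq_succ h.sq 0]; rfl
    _ = conjSeq ρ 2 * conjSeq ρ 0 := by rw [h.conj_two_conjSeq_zero]; rfl

theorem conjSeq_four_eq_of_commute (hrel : Commute (ρ 0) ((ρ 1 * ρ 2) ^ 4)) :
    conjSeq ρ 4 = conjSeq ρ 3 := by
  rw [← h.inv_conj_conjSeq_zero_eq_four, ← h.conj_conjSeq_zero_eq_three]
  rw [pow_mul (ρ 1 * ρ 2) 2 2] at hrel
  exact (conj_eq_inv_conj_of_commute_sq hrel).symm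

theorem commute_conjSeq_zero_four_iff :
    Commute (conjSeq ρ 0) (conjSeq ρ 4) ↔ comm (ρ 0) ((ρ 1 * ρ 2) ^ 2) ^ 2 = 1 := by
  rw [comm_sq_eq_one_iff (h.sq 0), ← h.inv_conj_conjSeq_zero_eq_four]
  rfl

theorem commute_conjSeq_of_lt_two : ∀ j < 2, ∀ i < j, Commute (conjSeq ρ i) (conjSeq ρ j) := by
  intro j hj i hi
  interval_cases j <;> interval_cases i
  exact h.commute_conjSeq_zero_one

theorem commute_conjSeq_of_lt_three (hrel : conjSeq ρ 1 * conjSeq ρ 3 = conjSeq ρ 2 * conjSeq ρ 0) :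
    ∀ j < 3, ∀ i < j, Commute (conjSeq ρ i) (conjSeq ρ j) := by
  have h₁₂ : Commute (conjSeq ρ 1) (conjSeq ρ 2) := by
    rw [eq_mul_inv_of_mul_eq hrel.symm]
    exact ((Commute.refl _).mul_right h.commute_conjSeq_one_three).mul_right
      h.commute_conjSeq_zero_one.symm.inv_right
  intro j hj i hi
  interval_cases j <;> interval_cases i
  exacts [h.commute_conjSeq_zero_one, h.commute_conjSeq_zero_two, h₁₂]

theorem commute_conjSeq_of_lt_four (hrel : conjSeq ρ 4 = conjSeq ρ 3)
    (h₀₄ : Commute (conjSeq ρ 0) (conjSeq ρ 4)) :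
    ∀ j < 4, ∀ i < j, Commute (conjSeq ρ i) (conjSeq ρ j) := by
  have h₀₃ : Commute (conjSeq ρ 0) (conjSeq ρ 3) := hrel ▸ h₀₄
  have h₁₂ : Commute (conjSeq ρ 1) (conjSeq ρ 2) :=
    (commute_conjSeq_succ_left h.sq (i := 0) (j := 2) rfl).2 h₀₃
  have h₂₃ : Commute (conjSeq ρ 2) (conjSeq ρ 3) :=
    (commute_conjSeq_succ_left h.sq (i := 1) (j := 3) rfl).2 (hrel ▸ h.commute_conjSeq_one_three)
  intro j hj i hi
  interval_cases j <;> interval_cases i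
  exacts [h.commute_conjSeq_zero_one, h.commute_conjSeq_zero_two, h₁₂, h₀₃,
    h.commute_conjSeq_one_three, h₂₃]

end SatisfiesBaseRels

end ConjugateRelations

section Families

variable {n : ℕ}

theorem isStringCGroup_card_hasSchlafliType_rels₁ (hn : 4 ≤ n) :
    IsStringCGroup (gen (rels₁ n)) ∧ Nat.card (G₁ n) = 2 ^ n ∧
      HasSchlafliType (gen (rels₁ n)) ![4, 2 ^ (n - 3)] := by
  obtain ⟨hbase, hrel⟩ := lift_rels₁_iff.1 fun _ => lift_gen_eq_one (R := rels₁ n)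
  have hmem : conjSeq (gen (rels₁ n)) 2 ∈ conjClosure (gen (rels₁ n)) 2 := by
    rw [hbase.conjSeq_two_eq_of_commute hrel]
    exact conjSeq_mem_conjClosure one_lt_two
  have key := isStringCGroup_card_hasSchlafliType hbase (by lia) (collapsesToDihedral_rels₁ n)
    le_rfl hbase.commute_conjSeq_of_lt_two hmem (lift_model₁ hn) isTriangular_model₁
  rwa [show 2 + (n - 3) + 1 = n by lia] at key

theorem isStringCGroup_card_hasSchlafliType_rels₃ (hn : 6 ≤ n) :
    IsStringCGroup (gen (rels₃ n)) ∧ Nat.card (G₃ n) = 2 ^ n ∧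
      HasSchlafliType (gen (rels₃ n)) ![4, 2 ^ (n - 4)] := by
  obtain ⟨hbase, hrel⟩ := lift_rels₃_iff.1 fun _ => lift_gen_eq_one (R := rels₃ n)
  have hprod := hbase.conjSeq_one_mul_three_eq_of_commute hrel
  have hmem : conjSeq (gen (rels₃ n)) 3 ∈ conjClosure (gen (rels₃ n)) 3 := by
    rw [eq_inv_mul_of_mul_eq hprod]
    exact mul_mem (inv_mem (conjSeq_mem_conjClosure (by lia)))
      (mul_mem (conjSeq_mem_conjClosure (by lia)) (conjSeq_mem_conjClosure (by lia)))
  have key := isStringCGroup_card_hasSchlafliType hbase (by lia) (collapsesToDihedral_rels₃ n)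
    (by lia) (hbase.commute_conjSeq_of_lt_three hprod) hmem (lift_model₃ hn) isTriangular_model₃
  rwa [show 3 + (n - 4) + 1 = n by lia] at key

theorem isStringCGroup_card_hasSchlafliType_rels₅ (hn : 7 ≤ n) :
    IsStringCGroup (gen (rels₅ n)) ∧ Nat.card (G₅ n) = 2 ^ n ∧
      HasSchlafliType (gen (rels₅ n)) ![4, 2 ^ (n - 5)] := by
  obtain ⟨hbase, hsq, hrel⟩ := lift_rels₅_iff.1 fun _ => lift_gen_eq_one (R := rels₅ n)
  have hfour := hbase.conjSeq_four_eq_of_commute hrel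
  have hmem : conjSeq (gen (rels₅ n)) 4 ∈ conjClosure (gen (rels₅ n)) 4 := by
    rw [hfour]
    exact conjSeq_mem_conjClosure (by lia)
  have hcomm := hbase.commute_conjSeq_of_lt_four hfour (hbase.commute_conjSeq_zero_four_iff.2 hsq)
  have key := isStringCGroup_card_hasSchlafliType hbase (by lia) (collapsesToDihedral_rels₅ n)
    (by lia) hcomm hmem (lift_model₅ hn) isTriangular_model₅
  rwa [show 4 + (n - 5) + 1 = n by lia] at key

end Families

end StringCGroup

theorem corollary3p1_general (n : ℕ) :
    (4 ≤ n →
      StringCGroup.IsStringCGroup (StringCGroup.gen (StringCGroup.rels₁ n)) ∧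
        Nat.card (StringCGroup.G₁ n) = 2 ^ n ∧
        StringCGroup.HasSchlafliType (StringCGroup.gen (StringCGroup.rels₁ n))
          ![4, 2 ^ (n - 3)]) ∧
    (6 ≤ n →
      StringCGroup.IsStringCGroup (StringCGroup.gen (StringCGroup.rels₃ n)) ∧
        Nat.card (StringCGroup.G₃ n) = 2 ^ n ∧
        StringCGroup.HasSchlafliType (StringCGroup.gen (StringCGroup.rels₃ n))
          ![4, 2 ^ (n - 4)]) ∧
    (7 ≤ n →
      StringCGroup.IsStringCGroup (StringCGroup.gen (StringCGroup.rels₅ n)) ∧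
        Nat.card (StringCGroup.G₅ n) = 2 ^ n ∧
        StringCGroup.HasSchlafliType (StringCGroup.gen (StringCGroup.rels₅ n))
          ![4, 2 ^ (n - 5)]) :=
  ⟨StringCGroup.isStringCGroup_card_hasSchlafliType_rels₁,
    StringCGroup.isStringCGroup_card_hasSchlafliType_rels₃,
    StringCGroup.isStringCGroup_card_hasSchlafliType_rels₅⟩

theorem corollary3p1 (n : ℕ) (hn : 10 ≤ n) :
    (StringCGroup.IsStringCGroup (StringCGroup.gen (StringCGroup.rels₁ n)) ∧
      Nat.card (StringCGroup.G₁ n) = 2 ^ n ∧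
      StringCGroup.HasSchlafliType (StringCGroup.gen (StringCGroup.rels₁ n))
        ![4, 2 ^ (n - 3)]) ∧
    (StringCGroup.IsStringCGroup (StringCGroup.gen (StringCGroup.rels₃ n)) ∧
      Nat.card (StringCGroup.G₃ n) = 2 ^ n ∧
      StringCGroup.HasSchlafliType (StringCGroup.gen (StringCGroup.rels₃ n))
        ![4, 2 ^ (n - 4)]) ∧
    (StringCGroup.IsStringCGroup (StringCGroup.gen (StringCGroup.rels₅ n)) ∧
      Nat.card (StringCGroup.G₅ n) = 2 ^ n ∧
      StringCGroup.HasSchlafliType (StringCGroup.gen (StringCGroup.rels₅ n))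
        ![4, 2 ^ (n - 5)]) := by
  obtain ⟨h₁, h₃, h₅⟩ := corollary3p1_general n
  exact ⟨h₁ (by lia), h₃ (by lia), h₅ (by lia)⟩
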